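/- Let \(N_{1}, \ldots, N_{k}\) be finitely generated torsion-free non-abelian nilpotent groups, put \(N = N_{1} \times \cdots \times N_{k}\), and let \(\phi \in \mathrm{Aut}(N)\). For \(i, j \in \{1, \ldots, k\}\) let \(\phi_{ij} = \pi_{i} \circ \phi \circ e_{j} : N_{j} \to N_{i}\), where \(\pi_{i} : N \to N_{i}\) is the canonical projection and \(e_{j} : N_{j} \to N\) the canonical inclusion. An endomorphism of \(N\) is determined by these entries, and we write \(\phi = (\phi_{ij})_{ij}\). Suppose that: 1) for each \(i \in \{1, \ldots, k\}\) there is a unique \(\sigma(i) \in \{1, \ldots, k\}\) such that \(\phi_{i\sigma(i)}\) is an isomorphism; 2) for each \(i \in \{1, \ldots, k\}\) and each \(j \ne \sigma(i)\), the map \(\phi_{ij}\) satisfies \(\operatorname{im} \phi_{ij} \leq Z(N_{i})\) and \(\phi_{ij}(Z(N_{j})) = 1\). Define \(\psi = (\psi_{ij})_{ij}\) by \(\psi_{ij} = \phi_{i\sigma(i)}\) if \(j = \sigma(i)\), and let \(\psi_{ij}\) be the trivial homomorphism otherwise. Then \(\psi\) is a (well-defined) automorphism of \(N\), and \(R(\phi)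 = R(\psi)\). Here, for an endomorphism \(\theta\) of a group \(G\), the Reidemeister number \(R(\theta) \in \{1, 2, \ldots\} \cup \{\infty\}\) is the number of equivalence classes of the relation on \(G\) given by \(x \sim y\) if and only if \(x = z y \theta(z)^{-1}\) for some \(z \in G\). -/

import Mathlib

/-- Twisted conjugacy: `x` and `y` are `φ`-conjugate if `x = z y φ(z)⁻¹` for some `z`. -/
def twistedConjSetoid {G : Type*} [Group G] (φ : G →* G) : Setoid G where
  r x y := ∃ z : G, x = z * y * (φ z)⁻¹
  iseqv := by
    refine ⟨fun x => ⟨1, by simp⟩, ?_, ?_⟩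
    · rintro x y ⟨z, rfl⟩
      exact ⟨z⁻¹, by simp [mul_assoc]⟩
    · rintro x y w ⟨z, rfl⟩ ⟨v, rfl⟩
      exact ⟨z * v, by simp [mul_assoc]⟩

/-- The Reidemeister number `R(φ)`: the number of `φ`-conjugacy classes, in `ℕ ∪ {∞}`. -/
noncomputable def reidemeisterNumber {G : Type*} [Group G] (φ : G →* G) : ℕ∞ :=
  ENat.card (Quotient (twistedConjSetoid φ))

/-- The entry `φ_{ij} = π_i ∘ φ ∘ e_j : G_j → G_i` of the matrix of an endomorphism `φ` of the
direct product of the groups `G_i`. -/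
def matrixEntry {ι : Type*} [DecidableEq ι] {G : ι → Type*} [∀ i, Group (G i)]
    (φ : (∀ i, G i) →* (∀ i, G i)) (i j : ι) : G j →* G i :=
  (Pi.evalMonoidHom G i).comp (φ.comp (MonoidHom.mulSingle G j))

/-- An endomorphism of a finite direct product is determined by its matrix. -/
theorem matrixEntry_ext {ι : Type*} [Finite ι] [DecidableEq ι] {G : ι → Type*}
    [∀ i, Group (G i)] {φ ψ : (∀ i, G i) →* (∀ i, G i)}
    (h : ∀ i j, matrixEntry φ i j = matrixEntry ψ i j) : φ = ψ := by
  refine MonoidHom.pi_ext fun j x => ?_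
  funext i
  exact DFunLike.congr_fun (h i j) x

/-! Let `Z` be the centre of `N`. The hypotheses on the entries make `φ` and `ψ` agree on `Z` and
modulo `Z`, so both induce the same `φ'` on `N ⧸ Z`. If `R(φ')` is infinite, so are `R(φ)` and
`R(ψ)`. Otherwise twisted conjugation by `φ'` has trivial stabilizers, so two elements of a coset `r
Z` are conjugate only through central elements. Each class of `φ'` then splits according to the map
on `Z` alone, and the counts coincide. Trivial stabilizers hold because a stabilizer is the fixed
subgroup of an endomorphism with finite Reidemeister number. Induction on nilpotency length shows
that subgroup is finite (`finite_fixedPoints_of_central`), hence trivial without torsion. -/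

/-- An endomorphism of a finitely generated abelian group whose image has finite index has finite
kernel. -/
theorem finite_ker_of_finiteIndex_range {A : Type*} [Group A] [Group.FG A]
    (hcomm : ∀ a b : A, a * b = b * a) (f : A →* A) [f.range.FiniteIndex] : Finite f.ker := by
  let _ : CommGroup A := { ‹Group A› with mul_comm := hcomm }
  let g : Additive A →ₗ[ℤ] Additive A := (MonoidHom.toAdditive f).toIntLinearMap
  have : Module.Finite ℤ (Additive A) := Module.Finite.iff_addGroup_fg.mpr inferInstance
  have hq : Module.finrank ℤ (Additive A ⧸ LinearMap.range g) = 0 := by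
    rw [Module.finrank_eq_zero_iff]
    intro x
    obtain ⟨y, rfl⟩ := Submodule.Quotient.mk_surjective _ x
    refine ⟨f.range.index, by exact_mod_cast Subgroup.FiniteIndex.index_ne_zero, ?_⟩
    rw [← Submodule.Quotient.mk_smul, Submodule.Quotient.mk_eq_zero]
    obtain ⟨z, hz⟩ := Subgroup.pow_index_mem f.range y.toMul
    refine ⟨Additive.ofMul z, ?_⟩
    rw [natCast_zsmul]
    exact congrArg Additive.ofMul hz
  -- Rank-nullity: kernel and cokernel have equal rank, here zero.
  have h1 := Submodule.finrank_quotient_add_finrank (LinearMap.range g)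
  have h2 := Submodule.finrank_quotient_add_finrank (LinearMap.ker g)
  rw [LinearEquiv.finrank_eq g.quotKerEquivRange] at h2
  have hk : Module.finrank ℤ (LinearMap.ker g) = 0 := by omega
  have : Finite (LinearMap.ker g) :=
    Module.finite_of_fg_torsion _ (Module.finrank_eq_zero_iff_isTorsion.mp hk)
  exact this

/-! ### Finite generation in the lower central series -/

namespace Subgroup

open scoped commutatorElement

/-- In a finitely generated group, each term of the lower central series is generated by finitely
many elements together with the next term. -/
theorem exists_finite_closure_sup_lowerCentralSeries {G : Type*} [Group G] [Group.FG G] (n : ℕ) :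
    ∃ S : Set G, S.Finite ∧ lowerCentralSeries (⊤ : Subgroup G) n =
      closure S ⊔ lowerCentralSeries (⊤ : Subgroup G) (n + 1) := by
  obtain ⟨X, hX, hXfin⟩ := Group.fg_iff.mp ‹Group.FG G›
  induction n with
  | zero =>
    exact ⟨X, hXfin, by rw [hX, lowerCentralSeries_zero, top_sup_eq]⟩
  | succ n ih =>
    obtain ⟨S, hS, hgen⟩ := ih
    set γ := lowerCentralSeries (⊤ : Subgroup G)
    have hsucc : ∀ m, γ (m + 1) = ⁅γ m, ⊤⁆ := lowerCentralSeries_succ _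
    refine ⟨Set.image2 (fun s x => ⁅s, x⁆) S X, hS.image2 _ hXfin, ?_⟩
    set M := closure (Set.image2 (fun s x : G => ⁅s, x⁆) S X) ⊔ γ (n + 1 + 1)
    have hM : M ≤ γ (n + 1) := by
      refine sup_le ((closure_le _).mpr ?_) (lowerCentralSeries_antitone _ (Nat.le_succ _))
      rintro _ ⟨s, hs, x, -, rfl⟩
      rw [hsucc]
      refine commutator_mem_commutator ?_ (mem_top x)
      rw [hgen]
      exact mem_sup_left (subset_closure hs)
    have hMn : M.Normal := by
      rw [← commutator_top_right_le_iff]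
      calc ⁅M, ⊤⁆ ≤ ⁅γ (n + 1), ⊤⁆ := commutator_mono hM le_rfl
        _ = γ (n + 1 + 1) := (hsucc _).symm
        _ ≤ M := le_sup_right
    refine le_antisymm ?_ hM
    -- It suffices to test centrality modulo `M` on generators: `S` against `X`, and `γ (n + 1)`
    -- against everything.
    have hcen : γ n ≤ (center (G ⧸ M)).comap (QuotientGroup.mk' M) := by
      rw [hgen]
      have key : ∀ g h : G, ⁅g, h⁆ ∈ M →
          (QuotientGroup.mk' M) h * (QuotientGroup.mk' M) g =
            (QuotientGroup.mk' M) g * (QuotientGroup.mk' M) h := by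
        intro g h hgh
        rw [eq_comm, ← commutatorElement_eq_one_iff_mul_comm, ← map_commutatorElement]
        exact (QuotientGroup.eq_one_iff _).mpr hgh
      refine sup_le ((closure_le _).mpr ?_) ?_
      · intro s hs
        have hle : (⊤ : Subgroup G) ≤
            (centralizer {(QuotientGroup.mk' M) s}).comap (QuotientGroup.mk' M) := by
          rw [← hX, closure_le]
          intro x hx
          refine mem_centralizer_singleton_iff.mpr ?_
          exact key s x (mem_sup_left (subset_closure ⟨s, hs, x, hx, rfl⟩))
        refine mem_center_iff.mpr fun q => ?_
        obtain ⟨g, rfl⟩ := QuotientGroup.mk'_surjective M q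
        exact mem_centralizer_singleton_iff.mp (hle (mem_top g))
      · intro g hg
        refine mem_center_iff.mpr fun q => ?_
        obtain ⟨h, rfl⟩ := QuotientGroup.mk'_surjective M q
        refine key g h (mem_sup_right ?_)
        rw [hsucc]
        exact commutator_mem_commutator hg (mem_top h)
    rw [hsucc, commutator_le]
    intro g hg h _
    rw [← QuotientGroup.eq_one_iff, ← QuotientGroup.mk'_apply, map_commutatorElement,
      commutatorElement_eq_one_iff_mul_comm]
    exact (mem_center_iff.mp (hcen hg) _).symm

/-- The last nontrivial term of the lower central series of a finitely generated nilpotent group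
is finitely generated. -/
theorem fg_lowerCentralSeries_of_succ_eq_bot {G : Type*} [Group G] [Group.FG G] {n : ℕ}
    (h : lowerCentralSeries (⊤ : Subgroup G) (n + 1) = ⊥) :
    Group.FG (lowerCentralSeries (⊤ : Subgroup G) n) := by
  obtain ⟨S, hS, hgen⟩ := exists_finite_closure_sup_lowerCentralSeries (G := G) n
  rw [h, sup_bot_eq] at hgen
  rw [hgen]
  have := hS.to_subtype
  exact Group.closure_finite_fg S

end Subgroup

/-! ### Reidemeister numbers and fixed points -/

/-- An endomorphism compatible with `φ` along a surjection has finitely many twisted conjugacy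
classes if `φ` has. -/
theorem finite_twistedConj_of_surjective {G H : Type*} [Group G] [Group H] {φ : G →* G}
    {φ' : H →* H} {π : G →* H} (hπ : Function.Surjective π) (hφ : ∀ x, φ' (π x) = π (φ x))
    [Finite (Quotient (twistedConjSetoid φ))] : Finite (Quotient (twistedConjSetoid φ')) := by
  refine Finite.of_surjective
    (Quotient.map' (s₁ := twistedConjSetoid φ) (s₂ := twistedConjSetoid φ') π ?_) ?_
  · rintro x y ⟨z, rfl⟩
    exact ⟨π z, by simp [hφ]⟩
  · intro q
    induction q using Quotient.inductionOn' with | _ y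
    obtain ⟨x, rfl⟩ := hπ y
    exact ⟨Quotient.mk _ x, rfl⟩

/-- Let `K` be a central finitely generated subgroup of `G`, stable under `φ`. If `φ` has finitely
many twisted conjugacy classes and the endomorphism induced on `G ⧸ K` has finitely many fixed
points, then `φ` has finitely many fixed points. -/
theorem finite_fixedPoints_of_central {G : Type*} [Group G] {φ : G →* G} (K : Subgroup G)
    [K.Normal] [Group.FG K] (hK : K ≤ Subgroup.center G) (hφK : K ≤ K.comap φ)
    [Finite (Quotient (twistedConjSetoid φ))]
    (hfix : {x | QuotientGroup.map K K φ hφK x = x}.Finite) : {x | φ x = x}.Finite := by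
  set π := QuotientGroup.mk' K
  -- `S` is the preimage of the fixed points on `G ⧸ K`; since `K` is central, `z ↦ z φ(z)⁻¹` is a
  -- homomorphism `S →* K`.
  let S : Subgroup G := (π.comp φ).eqLocus π
  have hS : ∀ z : G, z ∈ S ↔ z * (φ z)⁻¹ ∈ K := fun z => by
    rw [← QuotientGroup.eq_one_iff (N := K), QuotientGroup.mk_mul, QuotientGroup.mk_inv,
      mul_inv_eq_one, eq_comm]
    rfl
  have hcomm : ∀ a ∈ K, ∀ g, g * a = a * g := fun a ha => Subgroup.mem_center_iff.mp (hK ha)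
  let d : S →* K :=
    { toFun := fun z => ⟨z * (φ z)⁻¹, (hS z).mp z.2⟩
      map_one' := by simp
      map_mul' := fun z w => by
        ext
        have := hcomm _ ((hS w).mp w.2) (φ z)⁻¹
        simp only [Subgroup.coe_mul, map_mul, mul_inv_rev]
        rw [mul_assoc (z : G) (φ z)⁻¹, this]
        group }
  -- An element twisting one member of `K` into another lies in `S`, so cosets of `d.range` inject
  -- into the classes of `φ`.
  have hd : Finite (K ⧸ d.range) := by
    refine Finite.of_injective
      (fun q => (Quotient.mk (twistedConjSetoid φ) (q.out : K).1)) fun q q' h => ?_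
    obtain ⟨z, hz⟩ := Quotient.exact h
    rw [mul_assoc, ← hcomm _ (inv_mem q'.out.2 |> inv_mem_iff.mp), ← mul_assoc] at hz
    have hzS : z ∈ S := by
      rw [hS, ← mul_inv_eq_iff_eq_mul.mpr hz]
      exact mul_mem q.out.2 (inv_mem q'.out.2)
    rw [← q.out_eq', ← q'.out_eq', eq_comm]
    refine QuotientGroup.eq.mpr ⟨⟨z, hzS⟩, ?_⟩
    ext
    simp only [Subgroup.coe_mul, Subgroup.coe_inv]
    rw [← hcomm _ (inv_mem q'.out.2), hz, mul_inv_cancel_right]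
    rfl
  have hKS : K ≤ S := fun z hz => (hS z).mpr (mul_mem hz (inv_mem (hφK hz)))
  have hindex : (Subgroup.inclusion hKS).range.FiniteIndex := by
    let f : S →* G ⧸ K := π.comp S.subtype
    have : Finite f.range := by
      refine (hfix.subset ?_).to_subtype
      rintro _ ⟨z, rfl⟩
      exact z.2
    have hker : f.ker = (Subgroup.inclusion hKS).range := by
      rw [Subgroup.inclusion_range, ← MonoidHom.comap_ker, QuotientGroup.ker_mk']
      rfl
    rw [← hker]
    infer_instance
  -- `K` has finite index in `S`, so `d` restricted to `K` still has image of finite index; its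
  -- kernel is the set of fixed points in `K`.
  have hd' : (d.comp (Subgroup.inclusion hKS)).range.FiniteIndex := by
    rw [MonoidHom.range_comp]
    have := Subgroup.finiteIndex_of_finite_quotient (H := d.range)
    have : ((Subgroup.inclusion hKS).range ⊔ d.ker).FiniteIndex :=
      Subgroup.finiteIndex_of_le le_sup_left
    refine ⟨?_⟩
    rw [Subgroup.index_map]
    exact mul_ne_zero Subgroup.FiniteIndex.index_ne_zero Subgroup.FiniteIndex.index_ne_zero
  have hfin := finite_ker_of_finiteIndex_range
    (fun a b => Subtype.ext (hcomm b b.2 a)) (d.comp (Subgroup.inclusion hKS))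
  have hfinK : {x | x ∈ K ∧ φ x = x}.Finite := by
    refine (Set.finite_range fun x : (d.comp (Subgroup.inclusion hKS)).ker => (x.1 : G)).subset ?_
    rintro x ⟨hx, hfx⟩
    refine ⟨⟨⟨x, hx⟩, ?_⟩, rfl⟩
    rw [MonoidHom.mem_ker]
    ext
    simp [d, hfx]
  refine Set.Finite.of_finite_fibers π (hfix.subset ?_) ?_
  · rintro _ ⟨x, hx, rfl⟩
    exact congrArg π hx
  · rintro _ ⟨x, hx, rfl⟩
    refine (hfinK.image (x * ·)).subset ?_
    rintro y ⟨hy, hyx⟩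
    refine ⟨x⁻¹ * y, ⟨QuotientGroup.eq.mp hyx.symm, ?_⟩, by simp⟩
    rw [map_mul, map_inv, hx, hy]

/-- An endomorphism of a finitely generated nilpotent group with finite Reidemeister number has
only finitely many fixed points. -/
theorem finite_fixedPoints_of_finite_twistedConj {G : Type*} [Group G] [Group.FG G]
    [Group.IsNilpotent G] (φ : G →* G) [Finite (Quotient (twistedConjSetoid φ))] :
    {x | φ x = x}.Finite := by
  obtain ⟨n, hn⟩ := Subgroup.nilpotent_iff_lowerCentralSeries.mp ‹Group.IsNilpotent G›
  clear ‹Group.IsNilpotent G›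
  induction n generalizing G with
  | zero =>
    refine (Set.finite_singleton 1).subset fun x _ => ?_
    exact Subgroup.mem_bot.mp (hn ▸ Subgroup.mem_top x)
  | succ n ih =>
    let K := Subgroup.lowerCentralSeries (⊤ : Subgroup G) n
    have hK : K ≤ Subgroup.center G := by
      rw [Subgroup.lowerCentralSeries_succ, Subgroup.commutator_eq_bot_iff_le_centralizer,
        Subgroup.coe_top, Subgroup.centralizer_univ] at hn
      exact hn
    have hφK : K ≤ K.comap φ := by
      rw [← Subgroup.map_le_iff_le_comap, Subgroup.map_lowerCentralSeries]
      exact Subgroup.lowerCentralSeries_mono n le_top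
    have : Group.FG K := Subgroup.fg_lowerCentralSeries_of_succ_eq_bot hn
    have : Finite (Quotient (twistedConjSetoid (QuotientGroup.map K K φ hφK))) :=
      finite_twistedConj_of_surjective (QuotientGroup.mk'_surjective K) fun _ => rfl
    refine finite_fixedPoints_of_central K hK hφK (ih _ ?_)
    rw [← Subgroup.map_top_of_surjective _ (QuotientGroup.mk'_surjective K),
      ← Subgroup.map_lowerCentralSeries]
    exact QuotientGroup.map_mk'_self K

/-! ### Torsion-free nilpotent groups -/

/-- In a torsion-free nilpotent group, an element with a nontrivial central power is central. -/
theorem mem_center_of_pow_mem_center {G : Type*} [Group G] [Group.IsNilpotent G]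
    (htf : ∀ g : G, IsOfFinOrder g → g = 1) {x : G} {n : ℕ} (hn : 0 < n)
    (hx : x ^ n ∈ Subgroup.center G) : x ∈ Subgroup.center G := by
  obtain ⟨m, hm⟩ := Group.IsNilpotent.nilpotent G
  have key : ∀ i, ∀ y ∈ Subgroup.upperCentralSeries G i, y * x = x * y := by
    intro i
    induction i with
    | zero =>
      intro y hy
      rw [Subgroup.upperCentralSeries_zero, Subgroup.mem_bot] at hy
      simp [hy]
    | succ i ih =>
      intro y hy
      -- The commutator lies one step lower, so it commutes with `x`; its `n`-th power is then
      -- trivial.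
      have hc : Commute (y * x * y⁻¹ * x⁻¹) x :=
        ih _ (Subgroup.mem_upperCentralSeries_succ_iff.mp hy x)
      have hpow : (y * x * y⁻¹ * x⁻¹) ^ n = 1 := by
        have h1 : (y * x * y⁻¹ * x⁻¹ * x) ^ n = x ^ n := by
          rw [inv_mul_cancel_right, conj_pow, Subgroup.mem_center_iff.mp hx y,
            mul_inv_cancel_right]
        rwa [hc.mul_pow, mul_eq_right] at h1
      have h1 := htf _ (isOfFinOrder_iff_pow_eq_one.mpr ⟨n, hn, hpow⟩)
      rwa [mul_inv_eq_one, mul_inv_eq_iff_eq_mul] at h1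
  exact Subgroup.mem_center_iff.mpr fun y => key m y (hm ▸ Subgroup.mem_top y)

/-- The quotient of a torsion-free nilpotent group by its centre is torsion-free. -/
theorem torsionFree_quotient_center {G : Type*} [Group G] [Group.IsNilpotent G]
    (htf : ∀ g : G, IsOfFinOrder g → g = 1) (q : G ⧸ Subgroup.center G) (hq : IsOfFinOrder q) :
    q = 1 := by
  obtain ⟨x, rfl⟩ := QuotientGroup.mk_surjective q
  obtain ⟨n, hn, h⟩ := isOfFinOrder_iff_pow_eq_one.mp hq
  rw [← QuotientGroup.mk_pow, QuotientGroup.eq_one_iff] at h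
  exact (QuotientGroup.eq_one_iff x).mpr (mem_center_of_pow_mem_center htf hn h)

/-- If an endomorphism of a finitely generated torsion-free nilpotent group has finite Reidemeister
number, then twisted conjugation has trivial stabilizers. -/
theorem eq_one_of_twistedConj_eq_self {G : Type*} [Group G] [Group.FG G] [Group.IsNilpotent G]
    (htf : ∀ g : G, IsOfFinOrder g → g = 1) {φ : G →* G}
    [Finite (Quotient (twistedConjSetoid φ))] {y z : G} (h : z * y * (φ z)⁻¹ = y) : z = 1 := by
  -- The stabilizer of `y` is the fixed subgroup of `τ`, and right translation by `y⁻¹` carries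
  -- `φ`-classes to `τ`-classes.
  let τ : G →* G := (MulAut.conj y).toMonoidHom.comp φ
  have hτ : ∀ x, τ x = y * φ x * y⁻¹ := fun _ => rfl
  have : Finite (Quotient (twistedConjSetoid τ)) := by
    refine Finite.of_surjective (Quotient.map' (s₁ := twistedConjSetoid φ)
      (s₂ := twistedConjSetoid τ) (· * y⁻¹) ?_) ?_
    · rintro a b ⟨w, rfl⟩
      exact ⟨w, by simp [hτ, mul_assoc]⟩
    · intro q
      induction q using Quotient.inductionOn' with | _ a
      exact ⟨Quotient.mk _ (a * y), congrArg (Quotient.mk _) (mul_inv_cancel_right a y)⟩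
  have hfix := finite_fixedPoints_of_finite_twistedConj τ
  have hz : τ z = z := by
    rw [hτ, ← mul_inv_eq_iff_eq_mul.mp h, mul_inv_cancel_right]
  apply htf
  have hpow : ∀ n : ℕ, z ^ n ∈ {x | τ x = x} := fun n => by simp [map_pow, hz]
  rw [← not_not (a := IsOfFinOrder z), ← injective_pow_iff_not_isOfFinOrder]
  intro hinj
  exact Set.infinite_range_of_injective hinj (hfix.subset (Set.range_subset_iff.mpr hpow))

/-- Two endomorphisms of a finitely generated torsion-free nilpotent group that agree on the centre
and modulo the centre have the same Reidemeister number. -/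
theorem reidemeisterNumber_eq_of_agree_center {G : Type*} [Group G] [Group.FG G]
    [Group.IsNilpotent G] (htf : ∀ g : G, IsOfFinOrder g → g = 1) {φ ψ : G →* G}
    (hφ : Subgroup.center G ≤ (Subgroup.center G).comap φ)
    (hmod : ∀ x, (φ x : G ⧸ Subgroup.center G) = ψ x)
    (hcenter : ∀ x ∈ Subgroup.center G, φ x = ψ x) :
    reidemeisterNumber φ = reidemeisterNumber ψ := by
  set Z := Subgroup.center G
  set φ' := QuotientGroup.map Z Z φ hφ
  have hsurj := QuotientGroup.mk'_surjective Z
  unfold reidemeisterNumber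
  by_cases hfin : Finite (Quotient (twistedConjSetoid φ'))
  swap
  · have h1 : Infinite (Quotient (twistedConjSetoid φ)) := not_finite_iff_infinite.mp fun _ =>
      hfin (finite_twistedConj_of_surjective hsurj fun _ => rfl)
    have h2 : Infinite (Quotient (twistedConjSetoid ψ)) := not_finite_iff_infinite.mp fun _ =>
      hfin (finite_twistedConj_of_surjective hsurj fun x => hmod x)
    rw [ENat.card_eq_top_of_infinite, ENat.card_eq_top_of_infinite]
  let r : Quotient (twistedConjSetoid φ') → G := fun t => Quotient.out (Quotient.out t)
  have hr : ∀ t, QuotientGroup.mk' Z (r t) = Quotient.out t := fun t => Quotient.out_eq' _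
  have hcomm : ∀ a ∈ Z, ∀ g, g * a = a * g := fun a ha => Subgroup.mem_center_iff.mp ha
  -- `F χ` is onto, and its kernel depends only on `φ'` and on `χ` restricted to `Z`.
  let F (χ : G →* G) (p : Quotient (twistedConjSetoid φ') × Z) :
    Quotient (twistedConjSetoid χ) := Quotient.mk _ (r p.1 * p.2)
  have hF : ∀ χ : G →* G, (∀ x, φ' (QuotientGroup.mk' Z x) = QuotientGroup.mk' Z (χ x)) →
      Function.Surjective (F χ) ∧ ∀ p p', F χ p = F χ p' ↔
        p.1 = p'.1 ∧ ∃ w ∈ Z, (p.2 : G) = w * p'.2 * (χ w)⁻¹ := by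
    intro χ hχ
    constructor
    · intro q
      obtain ⟨x, rfl⟩ := Quotient.exists_rep q
      obtain ⟨v, hv⟩ := Quotient.exact (Quotient.out_eq
        (Quotient.mk (twistedConjSetoid φ') (QuotientGroup.mk' Z x)))
      obtain ⟨z, rfl⟩ := hsurj v
      rw [← hr, hχ, ← map_mul, ← map_inv, ← map_mul] at hv
      exact ⟨(_, ⟨_, QuotientGroup.eq.mp hv⟩), Quotient.sound ⟨z, mul_inv_cancel_left _ _⟩⟩
    · rintro ⟨t, c, hc⟩ ⟨t', c', hc'⟩
      have hone : ∀ a ∈ Z, QuotientGroup.mk' Z a = 1 := fun a ha =>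
        (QuotientGroup.eq_one_iff a).mpr ha
      constructor
      · intro h
        obtain ⟨z, hz⟩ := Quotient.exact h
        have hz' := congrArg (QuotientGroup.mk' Z) hz
        simp only [map_mul, map_inv, hone c hc, hone c' hc', mul_one, hr, ← hχ] at hz'
        obtain rfl : t = t' := by
          rw [← Quotient.out_eq t, ← Quotient.out_eq t']
          exact Quotient.sound ⟨_, hz'⟩
        have hzZ : z ∈ Z := (QuotientGroup.eq_one_iff z).mp
          (eq_one_of_twistedConj_eq_self (torsionFree_quotient_center htf) hz'.symm)
        refine ⟨rfl, z, hzZ, mul_left_cancel (a := r t) ?_⟩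
        simp only at hz
        rw [hz, ← mul_assoc z, ← hcomm z hzZ]
        simp only [mul_assoc]
      · rintro ⟨rfl, w, hw, h⟩
        refine Quotient.sound ⟨w, ?_⟩
        simp only at h ⊢
        rw [h, ← mul_assoc w, ← hcomm w hw (r t)]
        simp only [mul_assoc]
  obtain ⟨hs1, hk1⟩ := hF φ fun _ => rfl
  obtain ⟨hs2, hk2⟩ := hF ψ hmod
  have hker : Setoid.ker (F φ) = Setoid.ker (F ψ) := by
    ext p p'
    rw [Setoid.ker_def, Setoid.ker_def, hk1, hk2]
    refine and_congr_right fun _ => exists_congr fun w => and_congr_right fun hw => ?_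
    rw [hcenter w hw]
  exact ENat.card_congr ((Setoid.quotientKerEquivOfSurjective _ hs1).symm.trans
    ((Quotient.congrRight fun p p' => by rw [hker]).trans
      (Setoid.quotientKerEquivOfSurjective _ hs2)))

/-! ### Matrix entries and the centre; the main theorem -/

section Matrix

variable {ι : Type*} [DecidableEq ι] {G : ι → Type*} [∀ i, Group (G i)]

theorem mem_center_pi {x : ∀ i, G i} :
    x ∈ Subgroup.center (∀ i, G i) ↔ ∀ i, x i ∈ Subgroup.center (G i) := by
  simp only [Subgroup.mem_center_iff]
  refine ⟨fun h i g => ?_, fun h g => funext fun i => h i (g i)⟩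
  simpa using congrFun (h (Pi.mulSingle i g)) i

variable [Finite ι]

/-- Endomorphisms of a finite direct product agree modulo the centre if their entries do. -/
theorem mk_center_eq_of_matrixEntry {φ ψ : (∀ i, G i) →* (∀ i, G i)}
    (h : ∀ i j x, (matrixEntry φ i j x)⁻¹ * matrixEntry ψ i j x ∈ Subgroup.center (G i))
    (x : ∀ i, G i) : (φ x : (∀ i, G i) ⧸ Subgroup.center (∀ i, G i)) = ψ x := by
  refine DFunLike.congr_fun (f := (QuotientGroup.mk' _).comp φ) (g := (QuotientGroup.mk' _).comp ψ)
    (MonoidHom.pi_ext fun j y => ?_) x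
  exact QuotientGroup.eq.mpr (mem_center_pi.mpr fun i => h i j y)

/-- Endomorphisms of a finite direct product agree on the centre if their entries do. -/
theorem eq_on_center_of_matrixEntry {φ ψ : (∀ i, G i) →* (∀ i, G i)}
    (h : ∀ i j, ∀ x ∈ Subgroup.center (G j), matrixEntry φ i j x = matrixEntry ψ i j x)
    {x : ∀ i, G i} (hx : x ∈ Subgroup.center (∀ i, G i)) : φ x = ψ x := by
  let e : (∀ i, Subgroup.center (G i)) →* (∀ i, G i) :=
    MonoidHom.pi fun i => (Subgroup.center (G i)).subtype.comp (Pi.evalMonoidHom _ i)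
  refine DFunLike.congr_fun (f := φ.comp e) (g := ψ.comp e)
    (MonoidHom.pi_ext fun j y => ?_) (fun i => ⟨x i, mem_center_pi.mp hx i⟩)
  have he : e (Pi.mulSingle j y) = Pi.mulSingle j (y : G j) := by
    funext i
    exact Pi.apply_mulSingle (fun i (z : Subgroup.center (G i)) => (z : G i)) (fun _ => rfl) j y i
  funext i
  simp only [MonoidHom.comp_apply, he]
  exact h i j y y.2

end Matrix

theorem mainTheorem6 (k : ℕ) (N : Fin k → Type*) [∀ i, Group (N i)]
    (hfg : ∀ i, Group.FG (N i))
    (htf : ∀ i, ∀ g : N i, IsOfFinOrder g → g = 1)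
    (hnil : ∀ i, Group.IsNilpotent (N i))
    (hnonab : ∀ i, ∃ a b : N i, a * b ≠ b * a)
    (φ : (∀ i, N i) ≃* (∀ i, N i))
    (σ : Fin k → Fin k)
    (hσ : ∀ i, Function.Bijective (matrixEntry φ.toMonoidHom i (σ i)))
    (hσ_unique : ∀ i j, Function.Bijective (matrixEntry φ.toMonoidHom i j) → j = σ i)
    (himage : ∀ i j, j ≠ σ i →
      (matrixEntry φ.toMonoidHom i j).range ≤ Subgroup.center (N i))
    (hcentre : ∀ i j, j ≠ σ i →
      Subgroup.center (N j) ≤ (matrixEntry φ.toMonoidHom i j).ker) :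
    ∃ ψ : (∀ i, N i) ≃* (∀ i, N i),
      (∀ i j, matrixEntry ψ.toMonoidHom i j =
        if j = σ i then matrixEntry φ.toMonoidHom i j else 1) ∧
      reidemeisterNumber φ.toMonoidHom = reidemeisterNumber ψ.toMonoidHom := by
  -- If `σ` missed `j`, all of column `j` would kill the nontrivial centre of `N j`, against
  -- injectivity of `φ`.
  have hσsurj : Function.Surjective σ := by
    intro j
    by_contra! hj
    obtain ⟨a, b, hab⟩ := hnonab j
    have : Nontrivial (N j) := nontrivial_of_ne _ _ hab
    obtain ⟨⟨z, hz⟩, hz1⟩ := (Subgroup.center (N j)).ne_bot_iff_exists_ne_one.mp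
      (Group.IsNilpotent.center_ne_bot _)
    have hφz : φ (Pi.mulSingle j z) = 1 := funext fun i => hcentre i j (hj i).symm hz
    rw [map_eq_one_iff φ φ.injective, Pi.mulSingle_eq_one_iff] at hφz
    exact hz1 (Subtype.ext hφz)
  have hσinj : Function.Injective σ := Finite.injective_iff_surjective.mpr hσsurj
  let ψ : (∀ i, N i) →* (∀ i, N i) := MonoidHom.pi fun i =>
    (matrixEntry φ.toMonoidHom i (σ i)).comp (Pi.evalMonoidHom N (σ i))
  have hψ : Function.Bijective ψ := by
    constructor
    · intro x y hxy
      funext j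
      obtain ⟨i, rfl⟩ := hσsurj j
      exact (hσ i).1 (congrFun hxy i)
    · intro y
      choose g hg using fun i => (hσ i).2 (y i)
      let e := Equiv.ofBijective σ ⟨hσinj, hσsurj⟩
      refine ⟨(Equiv.piCongrLeft N e) g, funext fun i => ?_⟩
      rw [← hg i]
      exact congrArg (matrixEntry φ.toMonoidHom i (σ i)) (Equiv.piCongrLeft_apply_apply N e g i)
  have hentry : ∀ i j, matrixEntry ψ i j =
      if j = σ i then matrixEntry φ.toMonoidHom i j else 1 := by
    intro i j
    ext x
    have hx : matrixEntry ψ i j x =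
      matrixEntry φ.toMonoidHom i (σ i) (Pi.mulSingle j x (σ i)) := rfl
    rw [hx]
    split_ifs with h
    · subst h
      rw [Pi.mulSingle_eq_same]
    · rw [Pi.mulSingle_eq_of_ne (Ne.symm h), map_one, MonoidHom.one_apply]
  refine ⟨MulEquiv.ofBijective ψ hψ, hentry, ?_⟩
  have htfN : ∀ g : ∀ i, N i, IsOfFinOrder g → g = 1 := fun g hg =>
    funext fun i => htf i _ ((Pi.evalMonoidHom N i).isOfFinOrder hg)
  refine reidemeisterNumber_eq_of_agree_center htfN (ψ := ψ) ?_
    (mk_center_eq_of_matrixEntry fun i j x => ?_)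
    (fun x => eq_on_center_of_matrixEntry fun i j x hx => ?_)
  · intro x hx
    refine Subgroup.mem_center_iff.mpr fun g => ?_
    obtain ⟨g, rfl⟩ := φ.surjective g
    exact (map_mul φ g x).symm.trans
      ((congrArg φ (Subgroup.mem_center_iff.mp hx g)).trans (map_mul φ x g))
  · rw [hentry]
    split_ifs with h
    · rw [inv_mul_cancel]
      exact one_mem _
    · rw [MonoidHom.one_apply, mul_one]
      exact inv_mem (himage i j h ⟨x, rfl⟩)
  · rw [hentry]
    split_ifs with h
    · rfl
    · exact hcentre i j h hx
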